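/- Let $d\ge 1$ and let $\mathcal X_d=\{\langle k,i\rangle : k\ge 0,\ 1\le i\le d\}$; the type $\langle k,i\rangle$ is said to have level $k$. Let $\{\mathbf Z_n\}_{n\ge 0}$ be a multitype Galton--Watson process with type set $\mathcal X_d$: each individual lives for one generation and, independently of all others, at death produces a finite offspring vector $\mathbf r=(r_j)_{j\in\mathcal X_d}$ of non-negative integers with a law $p_i(\cdot)$ that depends on its type $i$, where an individual of level $k$ has no offspring of level larger than $k+1$ (a block lower Hessenberg branching process). The process is irreducible if for all $i,j\in\mathcal X_d$ there is a path from $i$ to $j$ in the directed graph on $\mathcal X_d$ with an edge $a\to b$ whenever $M(a,b)>0$, where $M(a,b)\in[0,\infty]$ is the expected number of type-$b$ children of a type-$a$ parent. Let $A\subseteq\mathcal X_d$. For $i\in\mathcal X_d$ let $q_{0,i}(A)$ be the probability that, starting from a single individual of type $i$, no individual with type in $A$ is present in any generation $n\ge 0$, and let $\mathbf q_0(A)=(q_{0,i}(A))_{i\in\mathcal X_d}$. For $\ell\ge 0$ let $\mathbf q^{(-1,\ell)}(A)$ be the vector of extinction probabilities (indexed by the initial type) of the process $\{\mathbf Z^{(-1,\ell)}_n(A)\}$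 obtained from $\{\mathbf Z_n\}$ by making all individuals with type in $A$ immortal and all individuals with type outside $A$ and level larger than $\ell$ sterile, all other individuals reproducing as in $\{\mathbf Z_n\}$. That is, the progeny generating function of this process is $0$ for the types in $A$, is $1$ for the types outside $A$ of level larger than $\ell$, and is that of $\{\mathbf Z_n\}$ for all other types. If $\{\mathbf Z_n\}$ is irreducible and $A$ is non-empty, then \[ \lim_{\ell\to\infty}\mathbf q^{(-1,\ell)}(A)=\mathbf q_0(A) \] entrywise. -/

import Mathlib

open Filter Topology MeasureTheory ProbabilityTheory
open scoped ENNReal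

noncomputable section

namespace Branching

/-- The type set: the type `⟨k, i⟩` has level `k ≥ 0` and one of `d` phases. -/
abbrev Ty (d : ℕ) : Type := ℕ × Fin d

/-- Offspring vectors (finitely many children in total): `r j` is the number of children of
type `j`. -/
abbrev Offspring (d : ℕ) : Type := Ty d →₀ ℕ

/-- The countable set of offspring vectors carries the discrete σ-algebra. -/
instance (d : ℕ) : MeasurableSpace (Offspring d) := ⊤

/-- The set `T_k` of types whose level is at most `k`; it is empty for `k = -1`. -/
def levelsUpTo (d : ℕ) (k : ℤ) : Set (Ty d) := {j | (j.1 : ℤ) ≤ k}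

/-- The offspring vectors available to a parent of level `k`: there are no children of a level
larger than `k + 1`. -/
def allowed (d k : ℕ) : Set (Offspring d) := {r | ∀ j : Ty d, k + 2 ≤ j.1 → r j = 0}

/-- The offspring distributions of a block lower Hessenberg branching process. -/
structure BlockLHBP (d : ℕ) where
  /-- The offspring law of a parent of type `i`. -/
  law : Ty d → PMF (Offspring d)
  law_allowed : ∀ i : Ty d, (law i).support ⊆ allowed d i.1

/-- Virtual individuals (Ulam-Harris labels): a root of some type, or the child number `m`
(counted from `0`) of type `j` of a virtual individual. -/
inductive Individual (d : ℕ) : Type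
  | root (i : Ty d) : Individual d
  | child (I : Individual d) (m : ℕ) (j : Ty d) : Individual d

namespace Individual

variable {d : ℕ}

/-- The type of a virtual individual. -/
def type : Individual d → Ty d
  | root i => i
  | child _ _ j => j

/-- The type of the root of the line of descent. -/
def initial : Individual d → Ty d
  | root i => i
  | child I _ _ => I.initial

/-- The generation of a virtual individual. -/
def generation : Individual d → ℕ
  | root _ => 0
  | child I _ _ => I.generation + 1

end Individual

/-- The sample space: an outcome assigns an offspring vector to every virtual individual. -/
abbrev Outcome (d : ℕ) : Type := Individual d → Offspring d

variable {d : ℕ}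

/-- The individual `I` appears in the population that descends from its root. -/
def Appears (N : Outcome d) : Individual d → Prop
  | .root _ => True
  | .child I m j => Appears N I ∧ m < N I j

/-- `Z_{n,j}`: the number of individuals of type `j` in generation `n`, for a population started
by one individual of type `i`. -/
def population (N : Outcome d) (i : Ty d) (n : ℕ) (j : Ty d) : ℕ∞ :=
  {I : Individual d | I.initial = i ∧ I.generation = n ∧ I.type = j ∧ Appears N I}.encard

/-- The event that, for a population started in type `i`, no individual with type in `A` is
present from generation `n` on. -/
def absentFrom (n : ℕ) (A : Set (Ty d)) (i : Ty d) : Set (Outcome d) :=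
  {N | ∀ m, n ≤ m → ∀ j ∈ A, population N i m j = 0}

open Classical in
/-- What happens to `I` in the modified process with parameters `k, ℓ, A`. The value `none`
means that `I` is immortal (generating function `0`): these are the individuals with type in `A`
and level above `k`. Individuals with type outside `A` and level above `ℓ` are sterile. All others
reproduce as in the original process. -/
def modifiedOffspring (k l : ℤ) (A : Set (Ty d)) (N : Outcome d) (I : Individual d) :
    Option (Offspring d) :=
  if I.type ∈ A ∩ (levelsUpTo d k)ᶜ then none
  else if I.type ∈ Aᶜ ∩ (levelsUpTo d l)ᶜ then some 0
  else some (N I)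

/-- The individual `I` is ever born in the modified process. -/
def ModAppears (k l : ℤ) (A : Set (Ty d)) (N : Outcome d) : Individual d → Prop
  | .root _ => True
  | .child I m j => ModAppears k l A N I ∧ ∃ r, modifiedOffspring k l A N I = some r ∧ m < r j

/-- The number of individuals of type `j` that are alive at time `n` in the modified process
started by one individual of type `i`. An individual lives for the single generation in which it
is born, except that an immortal one stays alive for ever. -/
def modPopulation (k l : ℤ) (A : Set (Ty d)) (N : Outcome d) (i : Ty d) (n : ℕ) (j : Ty d) : ℕ∞ :=
  {I : Individual d | I.initial = i ∧ I.type = j ∧ ModAppears k l A N I ∧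
    (I.generation = n ∨ (I.generation ≤ n ∧ modifiedOffspring k l A N I = none))}.encard

/-- The event that the modified process started in type `i` becomes extinct. -/
def modExtinct (k l : ℤ) (A : Set (Ty d)) (i : Ty d) : Set (Outcome d) :=
  {N | ∃ n, ∀ m, n ≤ m → ∀ j, modPopulation k l A N i m j = 0}

namespace BlockLHBP

variable (Z : BlockLHBP d)

/-- The virtual individuals have independent offspring vectors, and the one of `I` is distributed
according to the offspring law of the type of `I`. -/
def prob : Measure (Outcome d) := Measure.infinitePi fun I => (Z.law I.type).toMeasure

/-- The mean progeny matrix: the expected number of type-`j` children of a type-`i` parent,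
possibly infinite. -/
def mean (i j : Ty d) : ℝ≥0∞ := ∑' r : Offspring d, Z.law i r * (r j : ℝ≥0∞)

/-- There is a path between any two types in the mean progeny representation graph. -/
def Irreducible : Prop := ∀ i j : Ty d, Relation.ReflTransGen (fun a b => 0 < Z.mean a b) i j

/-- The vector `q_n(A)`; in particular `q_0(A)` is the vector of the probabilities that no
individual with type in `A` is ever produced. -/
def qAbsent (n : ℕ) (A : Set (Ty d)) (i : Ty d) : ℝ := Z.prob.real (absentFrom n A i)

/-- The vector `q^{(k,ℓ)}(A)` of the extinction probabilities of the modified process. -/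
def qMod (k l : ℤ) (A : Set (Ty d)) (i : Ty d) : ℝ := Z.prob.real (modExtinct k l A i)

/-- The progeny generating function. -/
def genFun (i : Ty d) (s : Ty d → ℝ≥0∞) : ℝ≥0∞ :=
  ∑' r : Offspring d, Z.law i r * r.prod fun j m => s j ^ m

open Classical in
/-- The progeny generating function that the modified process is required to have. -/
def modGenFun (k l : ℤ) (A : Set (Ty d)) (i : Ty d) (s : Ty d → ℝ≥0∞) : ℝ≥0∞ :=
  if i ∈ A ∩ (levelsUpTo d k)ᶜ then 0
  else if i ∈ Aᶜ ∩ (levelsUpTo d l)ᶜ then 1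
  else Z.genFun i s

/-- The modified process does have this progeny generating function, when an immortal individual
contributes `0`. -/
theorem lintegral_modifiedOffspring (k l : ℤ) (A : Set (Ty d)) (I : Individual d)
    (s : Ty d → ℝ≥0∞) :
    ∫⁻ N, (modifiedOffspring k l A N I).elim 0 (fun r => r.prod fun j m => s j ^ m) ∂Z.prob
      = Z.modGenFun k l A I.type s := by
  have hP : IsProbabilityMeasure Z.prob := by unfold prob; infer_instance
  unfold modifiedOffspring modGenFun
  split_ifs with h1 h2
  · simp
  · simp
  · have hm : Measurable fun r : Offspring d => r.prod fun j m => s j ^ m := measurable_from_top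
    have hmap : Z.prob.map (fun N => N I) = (Z.law I.type).toMeasure :=
      (measurePreserving_eval_infinitePi (fun I : Individual d => (Z.law I.type).toMeasure) I).map_eq
    have := lintegral_map (μ := Z.prob) hm (measurable_pi_apply I)
    simp only [Option.elim_some]
    rw [← this, hmap, lintegral_countable']
    unfold genFun
    refine tsum_congr fun r => ?_
    rw [PMF.toMeasure_apply_singleton _ _ (by trivial), mul_comm]

end BlockLHBP

end Branching

end

/-! Extinction of the modified process is squeezed between two events. It forbids every birth of a
type in `A`, because such an individual would be immortal. The events `modAvoids l A i` decrease in
`l` to `absentFrom 0 A i`, since a line of descent meets only finitely many levels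
(`iInter_modAvoids`); this gives the upper bound in the limit.

Conversely, for each fixed `l`, absence of `A` implies extinction up to a null set
(`prob_absentFrom_le_modExtinct`). Otherwise the process survives through parents of level at most
`l`, so infinitely many generations visit a finite set `K` of types. By irreducibility each visitor
has a chance of at least `ε > 0`, independent of the past, of producing a type in `A`. The event `G`
of infinitely many visits without `A` therefore satisfies `P(G) ≤ (1 - ε) P(G)` and is null
(`prob_absentFrom_inter_visits`). -/

namespace Branching

variable {d : ℕ}

/-! ### Countability of the labels, and the σ-algebras of past and future generations. -/

namespace Individual

/-- The line of descent of a virtual individual, as a root type and a list of steps. -/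
def lineage : Individual d → Ty d × List (ℕ × Ty d)
  | root i => (i, [])
  | child I m j => (I.lineage.1, (m, j) :: I.lineage.2)

theorem lineage_injective : Function.Injective (lineage (d := d)) := by
  intro I
  induction I with
  | root i =>
    intro J h
    cases J with
    | root j => simpa [lineage] using h
    | child J m j => simp [lineage] at h
  | child I m i ih =>
    intro J h
    cases J with
    | root j => simp [lineage] at h
    | child J n j =>
      simp only [lineage, Prod.mk.injEq, List.cons.injEq] at h
      obtain ⟨h1, ⟨rfl, rfl⟩, h2⟩ := h
      rw [ih (Prod.ext h1 h2)]

instance : Countable (Individual d) := lineage_injective.countable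

end Individual

/-- The σ-algebra generated by the offspring vectors of the individuals in `S`. -/
abbrev offspringAlgebra (S : Set (Individual d)) : MeasurableSpace (Outcome d) :=
  ⨆ I ∈ S, MeasurableSpace.comap (fun N : Outcome d => N I) inferInstance

theorem offspringAlgebra_mono {S T : Set (Individual d)} (h : S ⊆ T) :
    offspringAlgebra S ≤ offspringAlgebra T :=
  biSup_mono h

theorem offspringAlgebra_le (S : Set (Individual d)) :
    offspringAlgebra S ≤ (inferInstance : MeasurableSpace (Outcome d)) :=
  iSup₂_le fun I _ => (measurable_pi_apply I).comap_le

theorem measurableSet_offspringAlgebra {S : Set (Individual d)} {I : Individual d} (hI : I ∈ S)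
    (B : Set (Offspring d)) : MeasurableSet[offspringAlgebra S] {N : Outcome d | N I ∈ B} :=
  le_iSup₂ (f := fun I (_ : I ∈ S) =>
    MeasurableSpace.comap (fun N : Outcome d => N I) inferInstance) I hI _ ⟨B, trivial, rfl⟩

/-- The individuals of generation less than `n`. -/
def before (d n : ℕ) : Set (Individual d) := {I | I.generation < n}

/-- The individuals of generation at least `n`. -/
def since (d n : ℕ) : Set (Individual d) := {I | n ≤ I.generation}

theorem before_mono {m n : ℕ} (h : m ≤ n) : before d m ⊆ before d n :=
  fun _ hI => lt_of_lt_of_le hI h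

/-- Only the strict ancestors of `I` decide whether it is born, so this event is independent of the
offspring of generation `I.generation` and later. -/
theorem measurableSet_appears (I : Individual d) :
    MeasurableSet[offspringAlgebra (before d I.generation)] {N : Outcome d | Appears N I} := by
  induction I with
  | root i => exact MeasurableSet.univ
  | child I m j ih =>
    refine MeasurableSet.inter (s₁ := {N : Outcome d | Appears N I})
      (s₂ := {N : Outcome d | N I ∈ {r : Offspring d | m < r j}}) ?_ ?_
    · exact offspringAlgebra_mono (before_mono (Nat.le_succ _)) _ ih
    · exact measurableSet_offspringAlgebra (Nat.lt_succ_self I.generation) _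

theorem measurableSet_modAppears (k l : ℤ) (A : Set (Ty d)) (I : Individual d) :
    MeasurableSet {N : Outcome d | ModAppears k l A N I} := by
  induction I with
  | root i => exact MeasurableSet.univ
  | child I m j ih =>
    refine MeasurableSet.inter ih (s₂ := {N : Outcome d |
      ∃ r, modifiedOffspring k l A N I = some r ∧ m < r j}) ?_
    unfold modifiedOffspring
    split_ifs
    · simp
    · simp
    · simp only [Option.some.injEq, exists_eq_left']
      exact offspringAlgebra_le _ _
        (measurableSet_offspringAlgebra (Set.mem_singleton I) {r : Offspring d | m < r j})

/-! ### Pathwise comparison of the modified and the original population. -/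

theorem mem_absentFrom_zero {A : Set (Ty d)} {i : Ty d} {N : Outcome d} :
    N ∈ absentFrom 0 A i ↔ ∀ I : Individual d, I.initial = i → I.type ∈ A → ¬ Appears N I := by
  simp only [absentFrom, population, Set.mem_ofPred_eq, Set.encard_eq_zero,
    Set.eq_empty_iff_forall_notMem, not_and]
  constructor
  · intro h I hi hA
    exact h _ (Nat.zero_le _) _ hA I hi rfl rfl
  · rintro h m - j hj I hi - rfl
    exact h I hi hj

theorem Appears.of_modAppears {k l : ℤ} {A : Set (Ty d)} {N : Outcome d} {I : Individual d}
    (h : ModAppears k l A N I) : Appears N I := by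
  induction I with
  | root i => trivial
  | child I m j ih =>
    obtain ⟨h1, r, h2, h3⟩ := h
    refine ⟨ih h1, ?_⟩
    unfold modifiedOffspring at h2
    split_ifs at h2
    · simp only [Option.some.injEq] at h2
      simp [← h2] at h3
    · simp only [Option.some.injEq] at h2
      rwa [h2]

theorem levelsUpTo_neg_one : levelsUpTo d (-1) = ∅ := by
  ext j
  simp only [levelsUpTo, Set.mem_ofPred_eq, Set.mem_empty_iff_false, iff_false]
  omega

theorem modifiedOffspring_of_mem {l : ℤ} {A : Set (Ty d)} {N : Outcome d} {I : Individual d}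
    (h : I.type ∈ A) : modifiedOffspring (-1) l A N I = none := by
  simp [modifiedOffspring, levelsUpTo_neg_one, h]

theorem modifiedOffspring_of_level_le {l : ℤ} {A : Set (Ty d)} {N : Outcome d} {I : Individual d}
    (h : I.type ∉ A) (hl : (I.type.1 : ℤ) ≤ l) : modifiedOffspring (-1) l A N I = some (N I) := by
  simp [modifiedOffspring, levelsUpTo, h, hl]

theorem modifiedOffspring_of_lt_level {l : ℤ} {A : Set (Ty d)} {N : Outcome d} {I : Individual d}
    (h : I.type ∉ A) (hl : l < I.type.1) : modifiedOffspring (-1) l A N I = some 0 := by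
  simp [modifiedOffspring, levelsUpTo, h, hl]

/-- A parent in the modified process has type outside `A` and level at most `l`. -/
theorem ModAppears.parent {l : ℤ} {A : Set (Ty d)} {N : Outcome d} {I : Individual d} {m : ℕ}
    {j : Ty d} (h : ModAppears (-1) l A N (.child I m j)) :
    I.type ∉ A ∧ (I.type.1 : ℤ) ≤ l := by
  obtain ⟨-, r, h2, h3⟩ := h
  have hA : I.type ∉ A := fun hA => by simp [modifiedOffspring_of_mem hA] at h2
  refine ⟨hA, not_lt.1 fun hl => ?_⟩
  rw [modifiedOffspring_of_lt_level hA hl, Option.some.injEq] at h2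
  simp [← h2] at h3

/-- Raising `l` only makes sterile types fertile; the actual parents on the line of descent of `I`
were fertile already and keep their offspring. -/
theorem ModAppears.mono {l l' : ℤ} (hl : l ≤ l') {A : Set (Ty d)} {N : Outcome d}
    {I : Individual d} (h : ModAppears (-1) l A N I) : ModAppears (-1) l' A N I := by
  induction I with
  | root i => trivial
  | child I m j ih =>
    obtain ⟨hA, hle⟩ := h.parent
    obtain ⟨h1, r, h2, h3⟩ := h
    rw [modifiedOffspring_of_level_le hA hle] at h2
    exact ⟨ih h1, r, by rw [modifiedOffspring_of_level_le hA (hle.trans hl), h2], h3⟩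

/-- An individual that appears does so in the modified process with large `l`, unless one of its
ancestors has type in `A`. -/
theorem Appears.exists_modAppears {A : Set (Ty d)} {N : Outcome d} {I : Individual d}
    (h : Appears N I) :
    (∃ l : ℕ, ModAppears (-1) l A N I) ∨
      ∃ l : ℕ, ∃ J : Individual d, J.initial = I.initial ∧ J.type ∈ A ∧
        ModAppears (-1) l A N J := by
  induction I with
  | root i => exact .inl ⟨0, trivial⟩
  | child I m j ih =>
    obtain ⟨h1, h2⟩ := h
    rcases ih h1 with ⟨l, hl⟩ | hJ
    · by_cases hA : I.type ∈ A
      · exact .inr ⟨l, I, rfl, hA, hl⟩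
      -- The bound `l` keeps `I` in the process, and the level of `I` prevents it from being
      -- sterile.
      · refine .inl ⟨max l I.type.1, hl.mono (by simp), N I, ?_, h2⟩
        exact modifiedOffspring_of_level_le hA (by simp)
    · exact .inr hJ

/-- The event that no individual with type in `A` is born in the process modified with `k = -1`. -/
def modAvoids (l : ℤ) (A : Set (Ty d)) (i : Ty d) : Set (Outcome d) :=
  {N | ∀ I : Individual d, I.initial = i → I.type ∈ A → ¬ ModAppears (-1) l A N I}

theorem measurableSet_modAvoids (l : ℤ) (A : Set (Ty d)) (i : Ty d) :
    MeasurableSet (modAvoids l A i) := by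
  simp only [modAvoids, Set.ofPred_forall]
  exact MeasurableSet.iInter fun I => MeasurableSet.iInter fun _ => MeasurableSet.iInter fun _ =>
    (measurableSet_modAppears _ _ _ I).compl

theorem modAvoids_antitone (A : Set (Ty d)) (i : Ty d) :
    Antitone fun l : ℕ => modAvoids l A i :=
  fun _ _ hl _ hN I hi hA h => hN I hi hA (h.mono (by exact_mod_cast hl))

theorem iInter_modAvoids (A : Set (Ty d)) (i : Ty d) :
    ⋂ l : ℕ, modAvoids l A i = absentFrom 0 A i := by
  ext N
  simp only [Set.mem_iInter, mem_absentFrom_zero, modAvoids, Set.mem_ofPred_eq]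
  constructor
  · intro h I hi hA hI
    rcases hI.exists_modAppears (A := A) with ⟨l, hl⟩ | ⟨l, J, hJ, hJA, hl⟩
    · exact h l I hi hA hl
    · exact h l J (hJ.trans hi) hJA hl
  · exact fun h l I hi hA hI => h I hi hA (.of_modAppears hI)

/-- Once born, an individual with type in `A` is alive at all later times. -/
theorem modExtinct_subset_modAvoids (l : ℤ) (A : Set (Ty d)) (i : Ty d) :
    modExtinct (-1) l A i ⊆ modAvoids l A i := by
  rintro N ⟨n, hn⟩ I hi hA hI
  have := hn (max n I.generation) (le_max_left _ _) I.type
  rw [modPopulation, Set.encard_eq_zero] at this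
  exact Set.eq_empty_iff_forall_notMem.1 this I
    ⟨hi, rfl, hI, .inr ⟨le_max_right _ _, modifiedOffspring_of_mem hA⟩⟩

/-! ### Survival without `A` forces infinitely many visits to low levels. -/

/-- The event that no individual with type in `A` is present up to generation `n`, while some
individual of generation `n` has its type in `K`. -/
def avoidsAndVisits (A K : Set (Ty d)) (i : Ty d) (n : ℕ) : Set (Outcome d) :=
  {N | (∀ I : Individual d, I.initial = i → I.type ∈ A → I.generation ≤ n → ¬ Appears N I) ∧
    ∃ I : Individual d, (I.initial = i ∧ I.type ∈ K ∧ I.generation = n) ∧ Appears N I}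

/-- Avoidance is required only up to generation `n` precisely so that the event belongs to the past
of that generation. -/
theorem measurableSet_avoidsAndVisits (A K : Set (Ty d)) (i : Ty d) (n : ℕ) :
    MeasurableSet[offspringAlgebra (before d n)] (avoidsAndVisits A K i n) := by
  have key : ∀ I : Individual d, I.generation ≤ n →
      MeasurableSet[offspringAlgebra (before d n)] {N : Outcome d | Appears N I} := fun I hI =>
    offspringAlgebra_mono (before_mono hI) _ (measurableSet_appears I)
  refine MeasurableSet.inter
    (s₁ := {N : Outcome d |
      ∀ I : Individual d, I.initial = i → I.type ∈ A → I.generation ≤ n → ¬ Appears N I})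
    (s₂ := {N : Outcome d | ∃ I : Individual d,
      (I.initial = i ∧ I.type ∈ K ∧ I.generation = n) ∧ Appears N I}) ?_ ?_
  · simp only [Set.ofPred_forall]
    exact MeasurableSet.iInter fun I => MeasurableSet.iInter fun _ => MeasurableSet.iInter
      fun _ => MeasurableSet.iInter fun h => (key I h).compl
  · simp only [← exists_prop, Set.ofPred_exists]
    exact MeasurableSet.iUnion fun I => MeasurableSet.iUnion fun h => key I h.2.2.le

/-- If the modified process survives although no individual with type in `A` ever appears, then
infinitely many generations visit the types of level at most `l`. -/
theorem absentFrom_diff_modExtinct_subset (l : ℕ) (A : Set (Ty d)) (i : Ty d) :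
    absentFrom 0 A i \ modExtinct (-1) l A i ⊆
      absentFrom 0 A i ∩
        ⋂ n : ℕ, ⋃ m : ℕ, avoidsAndVisits A (levelsUpTo d l) i (n + m) := by
  rintro N ⟨hN, hE⟩
  refine ⟨hN, Set.mem_iInter.2 fun n => Set.mem_iUnion.2 ?_⟩
  rw [mem_absentFrom_zero] at hN
  simp only [modExtinct, Set.mem_ofPred_eq, not_exists, not_forall] at hE
  -- An individual alive at time `m` may itself be sterile, with level above `l`, but its parent has
  -- level at most `l`. Starting from `n + 1` puts that parent in generation `m - 1 ≥ n`.
  obtain ⟨m, hm, j, hj⟩ := hE (n + 1)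
  obtain ⟨I, hi, -, hI, hgen⟩ := Set.nonempty_iff_ne_empty.2
    (fun h => hj (Set.encard_eq_zero.2 h))
  -- Without types in `A` nobody is immortal, so whoever is alive at time `m` was born then.
  have hI0 : I.generation = m := by
    rcases hgen with h | ⟨-, h⟩
    · exact h
    · have hA : I.type ∉ A := fun hA => hN I hi hA (.of_modAppears hI)
      rcases le_or_gt (I.type.1 : ℤ) l with hl | hl
      · simp [modifiedOffspring_of_level_le hA hl] at h
      · simp [modifiedOffspring_of_lt_level hA hl] at h
  cases I with
  | root i => simp only [Individual.generation] at hI0; omega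
  | child I a b =>
    simp only [Individual.generation] at hI0
    refine ⟨m - 1 - n, fun J hJ hA _ => hN J hJ hA, I, ⟨hi, hI.parent.2, by omega⟩, ?_⟩
    exact .of_modAppears hI.1

theorem finite_levelsUpTo (l : ℕ) : (levelsUpTo d l).Finite := by
  refine ((Set.finite_Iic l).prod (Set.finite_univ (α := Fin d))).subset fun j hj => ?_
  simpa [levelsUpTo] using hj

/-- A conditional bound on each piece of a partition passes to the union. Subadditivity suffices for
the pieces cut by `F`, so `F` need not be measurable. -/
theorem measure_inter_iUnion_le {Ω : Type*} [MeasurableSpace Ω] {μ : Measure Ω} {F : Set Ω}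
    {Y : ℕ → Set Ω} (hY : ∀ n, MeasurableSet (Y n)) (hd : Pairwise (Function.onFun Disjoint Y))
    {c : ℝ≥0∞} (h : ∀ n, μ (Y n ∩ F) ≤ c * μ (Y n)) :
    μ ((⋃ n, Y n) ∩ F) ≤ c * μ (⋃ n, Y n) := by
  rw [measure_iUnion hd hY, Set.iUnion_inter, ← ENNReal.tsum_mul_left]
  exact (measure_iUnion_le _).trans (ENNReal.tsum_le_tsum h)

/-- Stated for an arbitrary `m` so that splitting by first visits stays inside the σ-algebra of the
past. -/
theorem measurableSet_disjointed {Ω : Type*} {m : MeasurableSpace Ω} {Y : ℕ → Set Ω} {n : ℕ}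
    (hY : ∀ k ≤ n, MeasurableSet[m] (Y k)) : MeasurableSet[m] (disjointed Y n) := by
  rw [disjointed_eq_inter_compl]
  exact (hY n le_rfl).inter
    (MeasurableSet.iInter fun k => MeasurableSet.iInter fun hk => (hY k hk.le).compl)

/-! ### Independence and the uniform chance of reaching `A`. -/

namespace BlockLHBP

variable (Z : BlockLHBP d)

instance : IsProbabilityMeasure Z.prob := by unfold prob; infer_instance

theorem prob_offspring_eq (I : Individual d) (r : Offspring d) :
    Z.prob {N | N I ∈ ({r} : Set (Offspring d))} = Z.law I.type r := by
  have hmap : Z.prob.map (fun N => N I) = (Z.law I.type).toMeasure :=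
    (measurePreserving_eval_infinitePi (fun I : Individual d => (Z.law I.type).toMeasure) I).map_eq
  rw [← PMF.toMeasure_apply_singleton _ r (by trivial), ← hmap,
    Measure.map_apply (measurable_pi_apply I) (by trivial)]
  rfl

theorem prob_inter_of_disjoint {S T : Set (Individual d)} (hST : Disjoint S T)
    {B W : Set (Outcome d)} (hB : MeasurableSet[offspringAlgebra S] B)
    (hW : MeasurableSet[offspringAlgebra T] W) : Z.prob (B ∩ W) = Z.prob B * Z.prob W := by
  have hind : iIndepFun (fun (I : Individual d) (N : Outcome d) => N I) Z.prob :=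
    iIndepFun_infinitePi (P := fun I : Individual d => (Z.law I.type).toMeasure)
      (X := fun _ r => r) fun _ => measurable_id
  exact (Indep_iff _ _ _).1 (indep_iSup_of_disjoint
    (fun I => (measurable_pi_apply I).comap_le) hind hST) B W hB hW

/-- If `A` can be reached from `x`, then the descendants of an individual of type `x` produce an
individual with type in `A` with a probability bounded below. -/
theorem exists_prob_reach {A : Set (Ty d)} {x y : Ty d}
    (hxy : Relation.ReflTransGen (fun a b => 0 < Z.mean a b) x y) (hy : y ∈ A) :
    ∃ ε : ℝ≥0∞, 0 < ε ∧ ∀ I : Individual d, I.type = x → ∃ W : Set (Outcome d),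
      MeasurableSet[offspringAlgebra (since d I.generation)] W ∧ ε ≤ Z.prob W ∧
      ∀ N ∈ W, Appears N I →
        ∃ J : Individual d, J.initial = I.initial ∧ J.type ∈ A ∧ Appears N J := by
  induction hxy using Relation.ReflTransGen.head_induction_on with
  | refl =>
    refine ⟨1, one_pos, fun I hI => ⟨Set.univ, MeasurableSet.univ, by simp, fun N _ hN => ?_⟩⟩
    exact ⟨I, rfl, hI ▸ hy, hN⟩
  | @head x z hxz _ ih =>
    obtain ⟨ε, hε, H⟩ := ih
    obtain ⟨r, hr⟩ : ∃ r, Z.law x r * (r z : ℝ≥0∞) ≠ 0 := by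
      by_contra! h
      exact hxz.ne' (ENNReal.tsum_eq_zero.2 h)
    have hr1 : Z.law x r ≠ 0 := left_ne_zero_of_mul hr
    have hr2 : 0 < r z := Nat.pos_of_ne_zero fun h => by simp [h] at hr
    refine ⟨Z.law x r * ε, ENNReal.mul_pos hr1 hε.ne', ?_⟩
    rintro I rfl
    -- If `I` has the offspring vector `r`, its child number `0` of type `z` is born. The event `W`
    -- for that child involves strictly later generations, so the two probabilities multiply.
    obtain ⟨W, hW, hWε, hWA⟩ := H (.child I 0 z) rfl
    have hsub : since d (Individual.child I 0 z).generation ⊆ since d I.generation :=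
      fun J hJ => (Nat.le_succ _).trans hJ
    refine ⟨{N | N I ∈ ({r} : Set (Offspring d))} ∩ W, ?_, ?_, ?_⟩
    · exact (measurableSet_offspringAlgebra (show I ∈ since d I.generation from le_refl I.generation) _).inter
        (offspringAlgebra_mono hsub _ hW)
    · rw [Z.prob_inter_of_disjoint (S := {I}) _
        (measurableSet_offspringAlgebra (Set.mem_singleton I) _) hW, prob_offspring_eq]
      · gcongr
      · exact Set.disjoint_singleton_left.2 (Nat.not_succ_le_self I.generation)
    · rintro N ⟨hN, hNW⟩ hI
      refine hWA N hNW ⟨hI, ?_⟩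
      rw [Set.mem_singleton_iff.1 hN]
      exact hr2

theorem exists_prob_reach_of_finite (hZ : Z.Irreducible) {A K : Set (Ty d)} (hA : A.Nonempty)
    (hK : K.Finite) :
    ∃ ε : ℝ≥0∞, 0 < ε ∧ ∀ I : Individual d, I.type ∈ K → ∃ W : Set (Outcome d),
      MeasurableSet[offspringAlgebra (since d I.generation)] W ∧ ε ≤ Z.prob W ∧
      ∀ N ∈ W, Appears N I →
        ∃ J : Individual d, J.initial = I.initial ∧ J.type ∈ A ∧ Appears N J := by
  obtain ⟨y, hy⟩ := hA
  choose ε hε H using fun x => Z.exists_prob_reach (hZ x y) hy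
  -- Finiteness of `K` keeps the infimum positive. For empty `K` it is `⊤`, and the claim is
  -- vacuous.
  refine ⟨hK.toFinset.inf ε, (Finset.lt_inf_iff ENNReal.zero_lt_top).2 fun x _ => hε x,
    fun I hI => ?_⟩
  obtain ⟨W, h1, h2, h3⟩ := H I.type I rfl
  exact ⟨W, h1, (Finset.inf_le (hK.mem_toFinset.2 hI)).trans h2, h3⟩

/-- On `B` the individual `I` is born, so absence of `A` excludes `W`. Since `B` lies in the past of
`I` and `W` in its future, they are independent. -/
theorem prob_inter_absentFrom_le {A : Set (Ty d)} {i : Ty d} {ε : ℝ≥0∞} {I : Individual d}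
    (hi : I.initial = i) {W : Set (Outcome d)}
    (hW : MeasurableSet[offspringAlgebra (since d I.generation)] W) (hε : ε ≤ Z.prob W)
    (hWA : ∀ N ∈ W, Appears N I →
      ∃ J : Individual d, J.initial = I.initial ∧ J.type ∈ A ∧ Appears N J)
    {B : Set (Outcome d)} (hB : MeasurableSet[offspringAlgebra (before d I.generation)] B)
    (hBI : ∀ N ∈ B, Appears N I) :
    Z.prob (B ∩ absentFrom 0 A i) ≤ (1 - ε) * Z.prob B := by
  have hd : Disjoint (before d I.generation) (since d I.generation) :=
    Set.disjoint_left.2 fun J (hJ : J.generation < _) (hJ' : _ ≤ J.generation) => not_lt_of_ge hJ' hJ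
  calc Z.prob (B ∩ absentFrom 0 A i) ≤ Z.prob (B ∩ Wᶜ) := by
        refine measure_mono fun N hN => ⟨hN.1, fun hNW => ?_⟩
        obtain ⟨J, h1, h2, h3⟩ := hWA N hNW (hBI N hN.1)
        exact mem_absentFrom_zero.1 hN.2 J (h1.trans hi) h2 h3
    _ = Z.prob B * Z.prob Wᶜ := Z.prob_inter_of_disjoint hd hB hW.compl
    _ ≤ (1 - ε) * Z.prob B := by
        rw [mul_comm, prob_compl_eq_one_sub (offspringAlgebra_le _ _ hW)]
        gcongr

/-! ### Infinitely many visits without `A` have probability zero. -/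

theorem prob_absentFrom_inter_visits (hZ : Z.Irreducible) {A K : Set (Ty d)} (hA : A.Nonempty)
    (hK : K.Finite) (i : Ty d) :
    Z.prob (absentFrom 0 A i ∩ ⋂ n : ℕ, ⋃ m : ℕ, avoidsAndVisits A K i (n + m)) = 0 := by
  obtain ⟨ε, hε, H⟩ := Z.exists_prob_reach_of_finite hZ hA hK
  set F := absentFrom 0 A i
  set V := avoidsAndVisits A K i
  have hVm : ∀ n, MeasurableSet (V n) := fun n =>
    offspringAlgebra_le _ _ (measurableSet_avoidsAndVisits A K i n)
  -- Split an event of the first `n` generations according to the first visitor of `K`.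
  have step : ∀ n, ∀ B ⊆ V n, MeasurableSet[offspringAlgebra (before d n)] B →
      Z.prob (B ∩ F) ≤ (1 - ε) * Z.prob B := by
    intro n B hBV hB
    have : Nonempty (Individual d) := ⟨.root i⟩
    obtain ⟨e, he⟩ := exists_surjective_nat (Individual d)
    let X : ℕ → Set (Outcome d) := fun k =>
      {N | ((e k).initial = i ∧ (e k).type ∈ K ∧ (e k).generation = n) ∧ Appears N (e k)}
    have hX : ∀ k, MeasurableSet[offspringAlgebra (before d n)] (X k) := by
      intro k
      by_cases h : (e k).initial = i ∧ (e k).type ∈ K ∧ (e k).generation = n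
      · simp only [X, h, true_and, and_self]
        exact h.2.2 ▸ measurableSet_appears (e k)
      · simp only [X, h, false_and, Set.ofPred_false]
        exact @MeasurableSet.empty _ (offspringAlgebra (before d n))
    have hBY : B = ⋃ k, B ∩ disjointed X k := by
      rw [← Set.inter_iUnion, iUnion_disjointed, eq_comm, Set.inter_eq_left]
      intro N hN
      obtain ⟨I, hI, hNI⟩ := (hBV hN).2
      obtain ⟨k, rfl⟩ := he I
      exact Set.mem_iUnion.2 ⟨k, hI, hNI⟩
    have hY : ∀ k, MeasurableSet[offspringAlgebra (before d n)] (B ∩ disjointed X k) := fun k =>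
      hB.inter (measurableSet_disjointed fun k _ => hX k)
    rw [hBY]
    refine measure_inter_iUnion_le (fun k => offspringAlgebra_le _ _ (hY k))
      (fun a b hab => (disjoint_disjointed X hab).mono Set.inter_subset_right
        Set.inter_subset_right) fun k => ?_
    by_cases h : (e k).initial = i ∧ (e k).type ∈ K ∧ (e k).generation = n
    · obtain ⟨W, h1, h2, h3⟩ := H (e k) h.2.1
      exact Z.prob_inter_absentFrom_le h.1 h1 h2 h3 (h.2.2.symm ▸ hY k)
        fun N hN => (disjointed_subset X k hN.2).2
    · have : B ∩ disjointed X k = ∅ :=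
        Set.eq_empty_iff_forall_notMem.2 fun N hN => h (disjointed_subset X k hN.2).1
      simp [this]
  -- Split by the first generation `n + m` at which `V` occurs; each piece is measurable in the past
  -- of that generation, so `step` applies.
  have hU : ∀ n, Z.prob ((⋃ m, V (n + m)) ∩ F) ≤ (1 - ε) * Z.prob (⋃ m, V (n + m)) := by
    intro n
    rw [← iUnion_disjointed (f := fun m => V (n + m))]
    have hY : ∀ m, MeasurableSet[offspringAlgebra (before d (n + m))]
        (disjointed (fun m => V (n + m)) m) := fun m =>
      measurableSet_disjointed fun k hk => offspringAlgebra_mono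
        (before_mono (Nat.add_le_add_left hk n)) _ (measurableSet_avoidsAndVisits A K i (n + k))
    exact measure_inter_iUnion_le (Y := disjointed fun m => V (n + m))
      (fun m => offspringAlgebra_le _ _ (hY m)) (disjoint_disjointed _)
      fun m => step (n + m) _ (disjointed_subset _ m) (hY m)
  set G := ⋂ n : ℕ, ⋃ m : ℕ, V (n + m)
  -- Each `V n` includes avoidance of `A` up to generation `n`, and on `G` such `n` are arbitrarily
  -- large.
  have hGF : G ⊆ F := by
    intro N hN
    refine mem_absentFrom_zero.2 fun I hI hIA => ?_
    obtain ⟨m, hm⟩ := Set.mem_iUnion.1 (Set.mem_iInter.1 hN I.generation)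
    exact hm.1 I hI hIA (Nat.le_add_right _ _)
  have hlim : Tendsto (fun n => (1 - ε) * Z.prob (⋃ m, V (n + m))) atTop
      (𝓝 ((1 - ε) * Z.prob G)) := by
    refine ENNReal.Tendsto.const_mul (tendsto_measure_iInter_atTop
      (fun n => (MeasurableSet.iUnion fun m => hVm _).nullMeasurableSet) ?_
      ⟨0, measure_ne_top _ _⟩) (.inr (by simp))
    intro a b hab N hN
    obtain ⟨m, hm⟩ := Set.mem_iUnion.1 hN
    exact Set.mem_iUnion.2 ⟨b - a + m, by rwa [← add_assoc, Nat.add_sub_cancel' hab]⟩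
  -- The unions decrease to `G`, and `G ⊆ F`, so the bound `hU` becomes in the limit a bound of `G`
  -- by itself.
  have hle : Z.prob G ≤ (1 - ε) * Z.prob G :=
    ge_of_tendsto' hlim fun n =>
      (measure_mono (Set.subset_inter (Set.iInter_subset _ n) hGF)).trans (hU n)
  rw [Set.inter_eq_right.2 hGF]
  by_contra h0
  have hlt : (1 - ε) * Z.prob G < 1 * Z.prob G :=
    ENNReal.mul_lt_mul_left h0 (measure_ne_top _ _)
      (ENNReal.sub_lt_self ENNReal.one_ne_top one_ne_zero hε.ne')
  rw [one_mul] at hlt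
  exact absurd hle hlt.not_ge

theorem prob_absentFrom_le_modExtinct (hZ : Z.Irreducible) {A : Set (Ty d)} (hA : A.Nonempty)
    (l : ℕ) (i : Ty d) : Z.prob (absentFrom 0 A i) ≤ Z.prob (modExtinct (-1) l A i) := by
  have h0 : Z.prob (absentFrom 0 A i \ modExtinct (-1) l A i) = 0 :=
    measure_mono_null (absentFrom_diff_modExtinct_subset l A i)
      (Z.prob_absentFrom_inter_visits hZ hA (finite_levelsUpTo l) i)
  exact measure_mono_ae (ae_le_set.2 h0)

end BlockLHBP

end Branching

/-! ### The squeeze, one initial type at a time. -/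

theorem mainTheorem11 (d : ℕ) (hd : 1 ≤ d) (Z : Branching.BlockLHBP d) (hZ : Z.Irreducible)
    (A : Set (Branching.Ty d)) (hA : A.Nonempty) :
    Filter.Tendsto (fun l : ℕ => Z.qMod (-1) (l : ℤ) A) Filter.atTop (nhds (Z.qAbsent 0 A)) := by
  refine tendsto_pi_nhds.2 fun i => ?_
  have hlim : Tendsto (fun l : ℕ => Z.prob (Branching.modAvoids l A i)) atTop
      (𝓝 (Z.prob (Branching.absentFrom 0 A i))) := by
    rw [← Branching.iInter_modAvoids]
    exact tendsto_measure_iInter_atTop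
      (fun l => (Branching.measurableSet_modAvoids _ A i).nullMeasurableSet)
      (Branching.modAvoids_antitone A i) ⟨0, measure_ne_top _ _⟩
  refine (ENNReal.tendsto_toReal (measure_ne_top _ _)).comp
    (tendsto_of_tendsto_of_tendsto_of_le_of_le tendsto_const_nhds hlim
      (fun l => Z.prob_absentFrom_le_modExtinct hZ hA l i)
      fun l => measure_mono (Branching.modExtinct_subset_modAvoids _ A i))
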